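/- Let $d \ge 1$ and $k \ge 3$ be integers. Let $\mathcal{C} = \{C_1, \dots, C_k\}$ be a $d$-arrangement of $k$ curves in $\mathbb{P}^2_{\mathbb{C}}$, i.e. a set of $k$ pairwise distinct smooth plane curves, all of degree $d$, such that every point of $\mathrm{Sing}(\mathcal{C})$ (the set of points lying on at least two of the curves) is an ordinary intersection point, i.e. the curves of $\mathcal{C}$ passing through it have pairwise distinct tangent lines there. Assume that $t_k = 0$, i.e. no point lies on all $k$ curves. Let $G$ be the Levi graph of $\mathcal{C}$: the bipartite graph whose vertices are the points of $\mathrm{Sing}(\mathcal{C})$ and the curves $C_1, \dots, C_k$, a point being joined to a curve if and only if it lies on that curve. Then $G$ has a matching of size $k$ (that is, consisting of $k$ pairwise disjoint edges); such a matching saturates all the vertices corresponding to $C_1, \dots, C_k$. -/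

import Mathlib

namespace CurveArrangement

open MvPolynomial

/-- The complex projective plane. -/
abbrev Plane : Type := Projectivization ℂ (Fin 3 → ℂ)

/-- The vector of partial derivatives of `F` at `v`. -/
noncomputable def grad (F : MvPolynomial (Fin 3) ℂ) (v : Fin 3 → ℂ) : Fin 3 → ℂ :=
  fun i => eval v (pderiv i F)

/-- The set of points of the projective plane on the curve `F = 0` (for `F` homogeneous, the
condition does not depend on the chosen representative of the point). -/
def curve (F : MvPolynomial (Fin 3) ℂ) : Set Plane :=
  {p | eval p.rep F = 0}

/-- The curve `F = 0` is smooth: the partial derivatives of `F` have no common zero on it. -/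
def IsSmooth (F : MvPolynomial (Fin 3) ℂ) : Prop :=
  ∀ v : Fin 3 → ℂ, v ≠ 0 → eval v F = 0 → grad F v ≠ 0

/-- The projective tangent line of the curve `F = 0` at `p`, given as the linear subspace
`{w | ∑ i, (∂F/∂Xᵢ)(p) wᵢ = 0}` of `ℂ³` (for `F` homogeneous, it does not depend on the chosen
representative of the point). -/
noncomputable def tangentLine (F : MvPolynomial (Fin 3) ℂ) (p : Plane) :
    Submodule ℂ (Fin 3 → ℂ) :=
  LinearMap.ker (∑ i, grad F p.rep i • (LinearMap.proj i : (Fin 3 → ℂ) →ₗ[ℂ] ℂ))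

/-- The multiplicity of `p`: the number of curves of the family passing through `p`. -/
noncomputable def mult {k : ℕ} (F : Fin k → MvPolynomial (Fin 3) ℂ) (p : Plane) : ℕ :=
  {i | p ∈ curve (F i)}.ncard

/-- The singular locus of the arrangement: the points where at least two curves meet. -/
def sing {k : ℕ} (F : Fin k → MvPolynomial (Fin 3) ℂ) : Set Plane :=
  {p | 2 ≤ mult F p}

/-- `t_r`: the number of points that lie on exactly `r` of the curves. -/
noncomputable def t {k : ℕ} (F : Fin k → MvPolynomial (Fin 3) ℂ) (r : ℕ) : ℕ∞ :=
  {p | mult F p = r}.encard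

/-- `p` is an ordinary point of the arrangement of the (smooth) curves `F i = 0`: locally it looks
like an intersection of lines, that is, the curves through `p` have pairwise distinct tangents. -/
def IsOrdinary {k : ℕ} (F : Fin k → MvPolynomial (Fin 3) ℂ) (p : Plane) : Prop :=
  ∀ i j, i ≠ j → p ∈ curve (F i) → p ∈ curve (F j) →
    tangentLine (F i) p ≠ tangentLine (F j) p

/-- The `k` curves with equations `F i = 0` form a `d`-arrangement. -/
structure IsDArrangement (d : ℕ) {k : ℕ} (F : Fin k → MvPolynomial (Fin 3) ℂ) : Prop where
  isHomogeneous : ∀ i, (F i).IsHomogeneous d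
  isSmooth : ∀ i, IsSmooth (F i)
  distinct : Function.Injective fun i => curve (F i)
  isOrdinary : ∀ p ∈ sing F, IsOrdinary F p

/-- The Levi graph: its vertices are the singular points (`Sum.inl p`) and the curves
(`Sum.inr i`); its edges are the incidences. -/
def leviGraph {k : ℕ} (F : Fin k → MvPolynomial (Fin 3) ℂ) :
    SimpleGraph (sing F ⊕ Fin k) where
  Adj
    | Sum.inl p, Sum.inr i => p.1 ∈ curve (F i)
    | Sum.inr i, Sum.inl p => p.1 ∈ curve (F i)
    | _, _ => False
  symm := ⟨by rintro (p | i) (q | j) h <;> exact h⟩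
  loopless := ⟨by rintro (p | i) h <;> exact h⟩

end CurveArrangement

/-!
Two curves of the arrangement meet transversally, so by Bézout's theorem they meet in exactly `d²`
points. Since no point lies on all the curves, every curve `C_i` carries `r_i > d²` singular points
(`IsDArrangement.sq_lt_ncard`): otherwise all the other curves would cut `C_i` in the same `d²`
points. The Gram matrix of the incidence vectors of the curves, indexed by the singular points, is
therefore `diag (r_i - d²) + d² J` with `J` the matrix of ones. It is positive definite, so the
incidence vectors are linearly independent. Hence any set of `s` curves carries at least `s`
singular points, and Hall's theorem yields the matching (`exists_injective_of_card_inter_eq`).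

The form of Bézout's theorem that is needed (`ncard_curve_inter`) is proved by comparing two
spaces of forms of large degree `m`. Let `F`, `G` be forms of degree `d` whose gradients are
independent at all their common zeros. They are coprime, so by the exactness of the Koszul complex
the degree `m` part of the ideal `(F, G)` has codimension `d²` in the space of all forms
(`finrank_idealPart_fin_three`). On the other hand, the forms vanishing at the points of a finite
set `T` have codimension `#T` for large `m` (`card_add_finrank_vanishingPart`). Taking for `T` a
set of common zeros shows that there are at most `d²` of them. For the converse, a form `H`
vanishing at all common zeros has to lie in `(F, G)`. For a linear form `ℓ` without zeros on
`F = G = 0`, the Jacobian criterion and Nakayama's lemma show that `(F, G, ℓ - 1)` is a radical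
ideal (`mem_affineIdeal_of_forall_eval_eq_zero`), so that it contains `H`. Taking homogeneous
components, `ℓ ^ n * H` lies in `(F, G)` for some `n` (`exists_pow_mul_mem`). Finally
multiplication by `ℓ` on the forms modulo `(F, G)` is surjective in large degrees, by the
Nullstellensatz, and as all these spaces have dimension `d²` it is also injective
(`exists_forall_mem_of_mul_mem`).
-/

namespace CurveArrangement

open MvPolynomial

/-! ### Homogeneous parts of an ideal generated by two forms -/

section Graded

attribute [local instance] MvPolynomial.gradedAlgebra

variable {σ K : Type*} [Field K]

lemma homogeneousComponent_mul_of_isHomogeneous {F : MvPolynomial σ K} {d : ℕ}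
    (hF : F.IsHomogeneous d) (A : MvPolynomial σ K) (e : ℕ) :
    homogeneousComponent (e + d) (A * F) = homogeneousComponent e A * F := by
  have h := DirectSum.coe_decompose_mul_add_of_right_mem (homogeneousSubmodule σ K)
    (i := e) (j := d) (a := A) (b := F) hF
  have h1 := decomposition.decompose'_apply (A * F) (e + d)
  have h2 := decomposition.decompose'_apply A e
  rw [← h1, ← h2]
  exact h

lemma isHomogeneous_span_pair {F G : MvPolynomial σ K} {d : ℕ} (hF : F.IsHomogeneous d)
    (hG : G.IsHomogeneous d) :
    (Ideal.span {F, G}).IsHomogeneous (homogeneousSubmodule σ K) := by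
  refine Ideal.homogeneous_span _ _ ?_
  rintro x (rfl | rfl)
  · exact ⟨d, hF⟩
  · exact ⟨d, hG⟩

lemma homogeneousComponent_mem_span_pair {F G : MvPolynomial σ K} {d : ℕ}
    (hF : F.IsHomogeneous d) (hG : G.IsHomogeneous d) {H : MvPolynomial σ K}
    (hH : H ∈ Ideal.span {F, G}) (n : ℕ) : homogeneousComponent n H ∈ Ideal.span {F, G} :=
  homogeneousComponent_mem_of_mem (isHomogeneous_span_pair hF hG) hH n

end Graded

section Koszul

variable {σ K : Type*} [Field K]

/-- The forms of degree `m` in the ideal `(F, G)`. -/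
noncomputable def idealPart (F G : MvPolynomial σ K) (m : ℕ) : Submodule K (MvPolynomial σ K) :=
  (Ideal.span {F, G}).restrictScalars K ⊓ homogeneousSubmodule σ K m

lemma mem_idealPart {F G H : MvPolynomial σ K} {m : ℕ} :
    H ∈ idealPart F G m ↔ H ∈ Ideal.span {F, G} ∧ H.IsHomogeneous m := Iff.rfl

/-- The linear map `(A, B) ↦ A F + B G` on pairs of forms of degree `e`. -/
noncomputable def pairMap (F G : MvPolynomial σ K) (e : ℕ) :
    homogeneousSubmodule σ K e × homogeneousSubmodule σ K e →ₗ[K] MvPolynomial σ K :=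
  (LinearMap.mulRight K F ∘ₗ (homogeneousSubmodule σ K e).subtype).coprod
    (LinearMap.mulRight K G ∘ₗ (homogeneousSubmodule σ K e).subtype)

lemma pairMap_apply (F G : MvPolynomial σ K) (e : ℕ)
    (P : homogeneousSubmodule σ K e × homogeneousSubmodule σ K e) :
    pairMap F G e P = P.1 * F + P.2 * G := by
  simp [pairMap]

lemma range_pairMap {F G : MvPolynomial σ K} {d : ℕ} (hF : F.IsHomogeneous d)
    (hG : G.IsHomogeneous d) (e : ℕ) :
    LinearMap.range (pairMap F G e) = idealPart F G (e + d) := by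
  ext H
  rw [LinearMap.mem_range, mem_idealPart]
  constructor
  · rintro ⟨⟨A, B⟩, rfl⟩
    rw [pairMap_apply]
    exact ⟨Ideal.mem_span_pair.2 ⟨A, B, rfl⟩,
      (IsHomogeneous.mul A.2 hF).add (IsHomogeneous.mul B.2 hG)⟩
  · rintro ⟨h, hH⟩
    obtain ⟨a, b, rfl⟩ := Ideal.mem_span_pair.1 h
    refine ⟨⟨⟨homogeneousComponent e a, homogeneousComponent_mem e a⟩,
      ⟨homogeneousComponent e b, homogeneousComponent_mem e b⟩⟩, ?_⟩
    rw [pairMap_apply, ← homogeneousComponent_mul_of_isHomogeneous hF,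
      ← homogeneousComponent_mul_of_isHomogeneous hG, ← map_add,
      homogeneousComponent_eq_self hH]

lemma pairMap_eq_zero_iff {F G : MvPolynomial σ K} {d : ℕ}
    (hG : G.IsHomogeneous d) (hG0 : G ≠ 0) (hFG : IsRelPrime F G) (e : ℕ)
    (P : homogeneousSubmodule σ K (e + d) × homogeneousSubmodule σ K (e + d)) :
    pairMap F G (e + d) P = 0 ↔
      ∃ C : homogeneousSubmodule σ K e, (P.1 : MvPolynomial σ K) = C * G ∧
        (P.2 : MvPolynomial σ K) = -(C * F) := by
  obtain ⟨A, B⟩ := P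
  rw [pairMap_apply]
  constructor
  · intro h
    dsimp only at h ⊢
    obtain ⟨C, hC⟩ : G ∣ (A : MvPolynomial σ K) :=
      hFG.symm.dvd_of_dvd_mul_right ⟨-B, by linear_combination h⟩
    refine ⟨⟨homogeneousComponent e C, homogeneousComponent_mem e C⟩, ?_⟩
    have hA : (A : MvPolynomial σ K) = homogeneousComponent e C * G := by
      rw [← homogeneousComponent_mul_of_isHomogeneous hG, mul_comm C G, ← hC,
        homogeneousComponent_eq_self A.2]
    refine ⟨hA, mul_right_cancel₀ hG0 ?_⟩
    rw [hA] at h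
    linear_combination h
  · rintro ⟨C, hA, hB⟩
    dsimp only at hA hB ⊢
    rw [hA, hB]
    ring

/-- The dimension count of the Koszul complex of two coprime forms. -/
lemma finrank_idealPart_add [Finite σ] {F G : MvPolynomial σ K} {d : ℕ} (hF : F.IsHomogeneous d)
    (hG : G.IsHomogeneous d) (hG0 : G ≠ 0) (hFG : IsRelPrime F G) (e : ℕ) :
    Module.finrank K (idealPart F G (e + d + d)) +
      Module.finrank K (homogeneousSubmodule σ K e) =
    2 * Module.finrank K (homogeneousSubmodule σ K (e + d)) := by
  have (n : ℕ) : Module.Finite K (homogeneousSubmodule σ K n) :=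
    Module.Finite.iff_fg.2 (homogeneousSubmodule_fg σ K n)
  let ψ : homogeneousSubmodule σ K e →ₗ[K]
      homogeneousSubmodule σ K (e + d) × homogeneousSubmodule σ K (e + d) :=
    { toFun := fun C => (⟨C * G, IsHomogeneous.mul C.2 hG⟩,
        ⟨-(C * F), (IsHomogeneous.mul C.2 hF).neg⟩)
      map_add' := fun C D => by
        ext1 <;> apply Subtype.ext <;> simp [add_mul, add_comm]
      map_smul' := fun c C => by
        ext1 <;> apply Subtype.ext <;> simp }
  have hψ : Function.Injective ψ := by
    intro C D h
    have h1 : (C : MvPolynomial σ K) * G = D * G := congrArg (fun P => (P.1 : MvPolynomial σ K)) h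
    exact Subtype.ext (mul_right_cancel₀ hG0 h1)
  have hker : LinearMap.ker (pairMap F G (e + d)) = LinearMap.range ψ := by
    ext P
    rw [LinearMap.mem_ker, pairMap_eq_zero_iff hG hG0 hFG, LinearMap.mem_range]
    refine exists_congr fun C => ⟨fun h => Prod.ext (Subtype.ext h.1.symm)
      (Subtype.ext h.2.symm), ?_⟩
    rintro rfl
    exact ⟨rfl, rfl⟩
  have h := (pairMap F G (e + d)).finrank_range_add_finrank_ker
  rw [hker, LinearMap.finrank_range_of_inj hψ, range_pairMap hF hG, Module.finrank_prod] at h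
  omega

lemma finrank_homogeneousSubmodule_fin_three (m : ℕ) :
    Module.finrank K (homogeneousSubmodule (Fin 3) K m) = (m + 2).choose 2 := by
  have hset : {x : Fin 3 →₀ ℕ | x.degree = m} =
      ↑((Finset.univ : Finset (Fin 3)).finsuppAntidiag m) := by
    ext x
    simp [Finset.mem_finsuppAntidiag, Finsupp.degree_eq_sum]
  rw [homogeneousSubmodule_eq_finsupp_supported, hset,
    (AddMonoidAlgebra.supportedEquivFinsupp _).finrank_eq, Module.finrank_finsupp_self]
  rw [← Nat.card_eq_fintype_card, Nat.card_coe_set_eq, Set.ncard_coe_finset,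
    Finset.card_finsuppAntidiag_nat_eq_choose]
  simp only [Finset.card_univ, Fintype.card_fin]
  rw [show 3 + m - 1 = m + 2 by omega, ← Nat.choose_symm (by omega)]
  congr 1
  omega

lemma finrank_idealPart_fin_three {F G : MvPolynomial (Fin 3) K} {d : ℕ} (hF : F.IsHomogeneous d)
    (hG : G.IsHomogeneous d) (hG0 : G ≠ 0) (hFG : IsRelPrime F G) {m : ℕ} (hm : 2 * d ≤ m) :
    Module.finrank K (idealPart F G m) + d ^ 2 =
      Module.finrank K (homogeneousSubmodule (Fin 3) K m) := by
  obtain ⟨e, rfl⟩ := Nat.exists_eq_add_of_le' hm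
  have h := finrank_idealPart_add hF hG hG0 hFG e
  rw [two_mul, ← add_assoc]
  simp only [finrank_homogeneousSubmodule_fin_three] at h ⊢
  have key (n : ℕ) : 2 * (n + 2).choose 2 = (n + 2) * (n + 1) := by
    rw [Nat.choose_two_right, Nat.mul_div_cancel' (Nat.even_mul_pred_self _).two_dvd]
    rfl
  have h0 := key e
  have h1 := key (e + d)
  have h2 := key (e + d + d)
  nlinarith

end Koszul

/-! ### Gradients and first-order expansions -/

section Gradient

lemma grad_add (F G : MvPolynomial (Fin 3) ℂ) (v : Fin 3 → ℂ) :
    grad (F + G) v = grad F v + grad G v := by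
  ext i; simp [grad]

lemma grad_sub (F G : MvPolynomial (Fin 3) ℂ) (v : Fin 3 → ℂ) :
    grad (F - G) v = grad F v - grad G v := by
  ext i; simp [grad]

lemma grad_mul (F G : MvPolynomial (Fin 3) ℂ) (v : Fin 3 → ℂ) :
    grad (F * G) v = eval v F • grad G v + eval v G • grad F v := by
  ext i; simp [grad]

lemma grad_C (a : ℂ) (v : Fin 3 → ℂ) : grad (C a) v = 0 := by
  ext i; simp [grad]

lemma grad_X (j : Fin 3) (v : Fin 3 → ℂ) : grad (X j) v = Pi.single j 1 := by
  ext i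
  simp only [grad, pderiv_X, Pi.single_apply]
  split_ifs <;> simp_all

/-- Euler's identity. -/
lemma grad_dotProduct_self {F : MvPolynomial (Fin 3) ℂ} {d : ℕ} (hF : F.IsHomogeneous d)
    (v : Fin 3 → ℂ) : grad F v ⬝ᵥ v = d * eval v F := by
  have h := congrArg (eval v) hF.sum_X_mul_pderiv
  simp only [map_sum, map_mul, eval_X, nsmul_eq_mul, map_natCast] at h
  rw [dotProduct_comm]
  exact h

/-- The maximal ideal of the polynomials vanishing at `v`. -/
noncomputable def pointIdeal (v : Fin 3 → ℂ) : Ideal (MvPolynomial (Fin 3) ℂ) :=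
  Ideal.span (Set.range fun i => X i - C (v i))

lemma X_sub_C_mem_pointIdeal (v : Fin 3 → ℂ) (i : Fin 3) : X i - C (v i) ∈ pointIdeal v :=
  Ideal.subset_span ⟨i, rfl⟩

/-- The polynomial `∑ i, c i * (X i - v i)`, the linear term at `v` of a polynomial with gradient
`c` there. -/
noncomputable def linearPart (v : Fin 3 → ℂ) : (Fin 3 → ℂ) →ₗ[ℂ] MvPolynomial (Fin 3) ℂ :=
  ∑ i, (LinearMap.proj i : (Fin 3 → ℂ) →ₗ[ℂ] ℂ).smulRight (X i - C (v i))

lemma linearPart_apply (v c : Fin 3 → ℂ) :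
    linearPart v c = ∑ i, c i • (X i - C (v i)) := by
  simp [linearPart]

lemma linearPart_mem_pointIdeal (v c : Fin 3 → ℂ) : linearPart v c ∈ pointIdeal v := by
  rw [linearPart_apply]
  exact Submodule.sum_mem _ fun i _ =>
    Submodule.smul_of_tower_mem _ _ (X_sub_C_mem_pointIdeal v i)

/-- First-order Taylor expansion. -/
lemma sub_linearPart_mem (v : Fin 3 → ℂ) (F : MvPolynomial (Fin 3) ℂ) :
    F - C (eval v F) - linearPart v (grad F v) ∈ pointIdeal v * pointIdeal v := by
  induction F using MvPolynomial.induction_on with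
  | C a => simp [grad_C]
  | add p q hp hq =>
    rw [grad_add, map_add, map_add, map_add]
    convert add_mem hp hq using 1
    ring
  | mul_X p j hp =>
    have hX : X j - C (v j) ∈ pointIdeal v := X_sub_C_mem_pointIdeal v j
    have hlin : linearPart v (Pi.single j 1) = X j - C (v j) := by
      rw [linearPart_apply, Finset.sum_eq_single j] <;> simp +contextual
    have h1 := Ideal.mul_mem_left _ (X j : MvPolynomial (Fin 3) ℂ) hp
    have h2 := Ideal.mul_mem_mul hX (linearPart_mem_pointIdeal v (grad p v))
    rw [grad_mul, grad_X, map_add, map_smul, map_smul, hlin, map_mul, eval_X, C_mul,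
      smul_eq_C_mul, smul_eq_C_mul]
    convert add_mem h1 h2 using 1
    ring

lemma mem_pointIdeal {v : Fin 3 → ℂ} {F : MvPolynomial (Fin 3) ℂ} :
    F ∈ pointIdeal v ↔ eval v F = 0 := by
  constructor
  · intro h
    have : pointIdeal v ≤ RingHom.ker (eval v) := by
      rw [pointIdeal, Ideal.span_le]
      rintro _ ⟨i, rfl⟩
      simp [RingHom.mem_ker]
    exact this h
  · intro h
    have h1 := Ideal.mul_le_left (sub_linearPart_mem v F)
    rw [h, C_0, sub_zero] at h1
    simpa using add_mem h1 (linearPart_mem_pointIdeal v (grad F v))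

lemma exists_eq_pointIdeal {M : Ideal (MvPolynomial (Fin 3) ℂ)} (hM : M.IsMaximal) :
    ∃ v, M = pointIdeal v := by
  obtain ⟨v, rfl⟩ := eq_vanishingIdeal_singleton_of_isMaximal ℂ hM
  refine ⟨v, ?_⟩
  ext F
  rw [mem_pointIdeal, mem_vanishingIdeal_singleton_iff, aeval_eq_eval]

/-- The Jacobian criterion: if the gradients at `v` of the elements of an ideal `J` span `ℂ³`,
then `J` agrees with the maximal ideal of `v` near `v`. -/
lemma exists_mul_mem_of_grad_span {J : Ideal (MvPolynomial (Fin 3) ℂ)} {v : Fin 3 → ℂ}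
    (hJ : J ≤ pointIdeal v)
    (hspan : Submodule.span ℂ ((fun F => grad F v) '' (J : Set (MvPolynomial (Fin 3) ℂ))) = ⊤) :
    ∃ r, eval v r = 1 ∧ ∀ f ∈ pointIdeal v, r * f ∈ J := by
  have key : ∀ c, linearPart v c ∈ J ⊔ pointIdeal v * pointIdeal v := by
    intro c
    have hc : c ∈ Submodule.span ℂ
      ((fun F => grad F v) '' (J : Set (MvPolynomial (Fin 3) ℂ))) := hspan ▸ Submodule.mem_top
    induction hc using Submodule.span_induction with
    | mem x hx =>
      obtain ⟨F, hF, rfl⟩ := hx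
      have h := sub_linearPart_mem v F
      rw [mem_pointIdeal.1 (hJ hF), C_0, sub_zero] at h
      have := sub_mem (Ideal.mem_sup_left hF : F ∈ J ⊔ pointIdeal v * pointIdeal v)
        (Ideal.mem_sup_right h)
      simpa using this
    | zero => simp
    | add x y _ _ hx hy => rw [map_add]; exact add_mem hx hy
    | smul a x _ hx => rw [map_smul]; exact Submodule.smul_of_tower_mem _ _ hx
  have hle : pointIdeal v ≤ J ⊔ pointIdeal v • pointIdeal v := by
    intro f hf
    have h := sub_linearPart_mem v f
    rw [mem_pointIdeal.1 hf, C_0, sub_zero] at h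
    simpa using add_mem (Ideal.mem_sup_right h : _ ∈ J ⊔ _) (key (grad f v))
  obtain ⟨r, hr, hrJ⟩ := Submodule.exists_sub_one_mem_and_smul_le_of_fg_of_le_sup
    (IsNoetherian.noetherian (pointIdeal v)) le_rfl hle
  refine ⟨r, ?_, fun f hf => hrJ (Submodule.smul_mem_pointwise_smul f r _ hf)⟩
  have := mem_pointIdeal.1 hr
  rw [map_sub, map_one] at this
  exact sub_eq_zero.1 this

/-- An ideal whose elements have spanning gradients at each of its zeros is a radical ideal. -/
lemma mem_of_forall_eval_eq_zero {J : Ideal (MvPolynomial (Fin 3) ℂ)}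
    (hJ : ∀ v, J ≤ pointIdeal v → Submodule.span ℂ
      ((fun F => grad F v) '' (J : Set (MvPolynomial (Fin 3) ℂ))) = ⊤)
    {H : MvPolynomial (Fin 3) ℂ} (hH : ∀ v, J ≤ pointIdeal v → eval v H = 0) : H ∈ J := by
  by_contra hHJ
  -- The colon ideal `(J : H)`.
  let Q : Ideal (MvPolynomial (Fin 3) ℂ) :=
    Submodule.comap (LinearMap.mulRight (MvPolynomial (Fin 3) ℂ) H) J
  have hQ : Q ≠ ⊤ := fun h => hHJ (by
    have : (1 : MvPolynomial (Fin 3) ℂ) ∈ Q := h ▸ Submodule.mem_top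
    simpa [Q] using this)
  obtain ⟨M, hM, hQM⟩ := Ideal.exists_le_maximal Q hQ
  obtain ⟨v, rfl⟩ := exists_eq_pointIdeal hM
  have hJQ : J ≤ Q := fun f hf => J.mul_mem_right H hf
  obtain ⟨r, hr, hrJ⟩ := exists_mul_mem_of_grad_span (hJQ.trans hQM) (hJ v (hJQ.trans hQM))
  have hrQ : r ∈ Q := hrJ H (mem_pointIdeal.2 (hH v (hJQ.trans hQM)))
  exact one_ne_zero (hr.symm.trans (mem_pointIdeal.1 (hQM hrQ)))

end Gradient

/-! ### Transversal pairs of forms -/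

/-- Two forms are transversal if their gradients are independent at all their common zeros other
than the origin. -/
def IsTransversal (F G : MvPolynomial (Fin 3) ℂ) : Prop :=
  ∀ v : Fin 3 → ℂ, v ≠ 0 → eval v F = 0 → eval v G = 0 →
    LinearIndependent ℂ ![grad F v, grad G v]

/-- A polynomial in three variables that is not a unit has a zero other than the origin: otherwise
it would divide powers of two different variables. -/
lemma exists_eval_eq_zero_of_not_isUnit {H : MvPolynomial (Fin 3) ℂ} (hH : ¬ IsUnit H) :
    ∃ v : Fin 3 → ℂ, v ≠ 0 ∧ eval v H = 0 := by
  by_contra! h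
  have hpow (i : Fin 3) : ∃ n : ℕ, H ∣ X i ^ n := by
    have hmem : (X i : MvPolynomial (Fin 3) ℂ) ∈ (Ideal.span {H}).radical := by
      rw [← vanishingIdeal_zeroLocus_eq_radical (K := ℂ), mem_vanishingIdeal_iff]
      intro v hv
      have hv0 : v = 0 := by
        by_contra hne
        refine h v hne ?_
        have := hv H (Ideal.mem_span_singleton_self H)
        rwa [aeval_eq_eval] at this
      simp [hv0]
    obtain ⟨n, hn⟩ := hmem
    exact ⟨n, Ideal.mem_span_singleton.1 hn⟩
  obtain ⟨m, hm⟩ := hpow 0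
  obtain ⟨n, hn⟩ := hpow 1
  have hX : IsRelPrime (X 0 : MvPolynomial (Fin 3) ℂ) (X 1) := by
    refine (X_prime.irreducible.isRelPrime_iff_not_dvd).2 ?_
    rw [X_dvd_X]
    decide
  exact hH ((hX.pow (m := m) (n := n)) hm hn)

lemma IsTransversal.isRelPrime {F G : MvPolynomial (Fin 3) ℂ} (h : IsTransversal F G) :
    IsRelPrime F G := by
  rintro H ⟨A, rfl⟩ ⟨B, rfl⟩
  by_contra hH
  obtain ⟨v, hv0, hv⟩ := exists_eval_eq_zero_of_not_isUnit hH
  have hli := h v hv0 (by simp [hv]) (by simp [hv])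
  rw [grad_mul, grad_mul, hv, zero_smul, zero_add, zero_smul, zero_add,
    LinearIndependent.pair_iff] at hli
  have hA := (hli (eval v B) (-eval v A) (by rw [smul_smul, smul_smul]; module)).2
  have h1 := (hli 1 0 (by rw [neg_eq_zero.1 hA]; simp)).1
  exact one_ne_zero h1

/-- The ideal cutting out the cone over `F = G = 0` in the affine plane `ℓ = 1`. -/
noncomputable def affineIdeal (F G : MvPolynomial (Fin 3) ℂ) (ℓ : MvPolynomial (Fin 3) ℂ) :
    Ideal (MvPolynomial (Fin 3) ℂ) :=
  Ideal.span {F, G} ⊔ Ideal.span {ℓ - 1}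

/-- For transversal forms of the same degree, the points of `F = G = 0` in an affine chart `ℓ = 1`
are reduced. -/
lemma mem_affineIdeal_of_forall_eval_eq_zero {F G ℓ : MvPolynomial (Fin 3) ℂ} {d : ℕ}
    (hF : F.IsHomogeneous d) (hG : G.IsHomogeneous d) (hFG : IsTransversal F G)
    (hℓ : ℓ.IsHomogeneous 1) {H : MvPolynomial (Fin 3) ℂ}
    (hH : ∀ v, eval v F = 0 → eval v G = 0 → eval v ℓ = 1 → eval v H = 0) :
    H ∈ affineIdeal F G ℓ := by
  have hFJ : F ∈ affineIdeal F G ℓ := Ideal.mem_sup_left (Ideal.subset_span (by simp))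
  have hGJ : G ∈ affineIdeal F G ℓ := Ideal.mem_sup_left (Ideal.subset_span (by simp))
  have hℓJ : ℓ - 1 ∈ affineIdeal F G ℓ := Ideal.mem_sup_right (Ideal.subset_span (by simp))
  have hz (v) (hv : affineIdeal F G ℓ ≤ pointIdeal v) :
      eval v F = 0 ∧ eval v G = 0 ∧ eval v ℓ = 1 := by
    refine ⟨mem_pointIdeal.1 (hv hFJ), mem_pointIdeal.1 (hv hGJ), ?_⟩
    have := mem_pointIdeal.1 (hv hℓJ)
    rwa [map_sub, map_one, sub_eq_zero] at this
  refine mem_of_forall_eval_eq_zero (fun v hv => ?_) fun v hv => ?_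
  · obtain ⟨h1, h2, h3⟩ := hz v hv
    have hE : grad (ℓ - 1) v ⬝ᵥ v = 1 := by
      rw [grad_sub, ← C_1, grad_C, sub_zero, grad_dotProduct_self hℓ, h3]
      simp
    have hv0 : v ≠ 0 := by
      rintro rfl
      simp at hE
    have hli : LinearIndependent ℂ ![grad (ℓ - 1) v, grad F v, grad G v] := by
      rw [Fintype.linearIndependent_iff]
      intro a ha
      rw [Fin.sum_univ_three] at ha
      simp only [Matrix.cons_val] at ha
      -- By Euler's identity, the pairing with `v` kills the gradients of `F` and `G`.
      have h0 : a 0 = 0 := by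
        have := congrArg (· ⬝ᵥ v) ha
        simpa [add_dotProduct, hE, grad_dotProduct_self hF, grad_dotProduct_self hG, h1, h2]
          using this
      rw [h0, zero_smul, zero_add] at ha
      obtain ⟨h4, h5⟩ := LinearIndependent.pair_iff.1 (hFG v hv0 h1 h2) _ _ ha
      intro i
      fin_cases i
      · exact h0
      · exact h4
      · exact h5
    refine top_unique ((hli.span_eq_top_of_card_eq_finrank' (by simp)).ge.trans
      (Submodule.span_mono ?_))
    rintro _ ⟨i, rfl⟩
    fin_cases i
    · exact ⟨_, hℓJ, rfl⟩
    · exact ⟨_, hFJ, rfl⟩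
    · exact ⟨_, hGJ, rfl⟩
  · obtain ⟨h1, h2, h3⟩ := hz v hv
    exact hH v h1 h2 h3

/-! ### Forms vanishing at finitely many points -/

lemma finrank_map_add_finrank_inf_ker {K V W : Type*} [Field K] [AddCommGroup V] [Module K V]
    [AddCommGroup W] [Module K W] (S : Submodule K V) [Module.Finite K S] (f : V →ₗ[K] W) :
    Module.finrank K (S.map f) + Module.finrank K (S ⊓ LinearMap.ker f : Submodule K V) =
      Module.finrank K S := by
  have h := (f.domRestrict S).finrank_range_add_finrank_ker
  rw [LinearMap.range_domRestrict, ← Submodule.finrank_map_subtype_eq, LinearMap.ker_domRestrict,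
    Submodule.map_comap_subtype] at h
  exact h

instance finite_homogeneousSubmodule (m : ℕ) :
    Module.Finite ℂ (homogeneousSubmodule (Fin 3) ℂ m) :=
  Module.Finite.iff_fg.2 (homogeneousSubmodule_fg _ _ m)

lemma eval_smul_of_isHomogeneous {F : MvPolynomial (Fin 3) ℂ} {d : ℕ} (hF : F.IsHomogeneous d)
    (a : ℂ) (v : Fin 3 → ℂ) : eval (a • v) F = a ^ d * eval v F := by
  rw [eval_eq', eval_eq', Finset.mul_sum]
  refine Finset.sum_congr rfl fun s hs => ?_
  rw [hF.degree_eq_sum_deg_support hs, ← Finsupp.degree_apply, Finsupp.degree_eq_sum]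
  simp only [Pi.smul_apply, smul_eq_mul, mul_pow, Finset.prod_mul_distrib,
    Finset.prod_pow_eq_pow_sum]
  ring

/-- The linear form with values given by a functional `f`. -/
noncomputable def linearForm (f : Module.Dual ℂ (Fin 3 → ℂ)) : MvPolynomial (Fin 3) ℂ :=
  ∑ i, C (f (Pi.single i 1)) * X i

lemma isHomogeneous_linearForm (f : Module.Dual ℂ (Fin 3 → ℂ)) :
    (linearForm f).IsHomogeneous 1 :=
  IsHomogeneous.sum _ _ _ fun i _ => isHomogeneous_C_mul_X _ i

lemma eval_linearForm (f : Module.Dual ℂ (Fin 3 → ℂ)) (v : Fin 3 → ℂ) :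
    eval v (linearForm f) = f v := by
  conv_rhs => rw [pi_eq_sum_univ' v]
  simp [linearForm, mul_comm, Pi.single]

/-- The forms of degree `m` vanishing on a finite set `T` of points. -/
noncomputable def vanishingPart (T : Finset Plane) (m : ℕ) :
    Submodule ℂ (MvPolynomial (Fin 3) ℂ) :=
  homogeneousSubmodule (Fin 3) ℂ m ⊓
    LinearMap.ker (LinearMap.pi fun p : T => (aeval p.1.rep).toLinearMap)

lemma mem_vanishingPart {T : Finset Plane} {m : ℕ} {H : MvPolynomial (Fin 3) ℂ} :
    H ∈ vanishingPart T m ↔ H.IsHomogeneous m ∧ ∀ p ∈ T, eval p.rep H = 0 := by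
  simp [vanishingPart, funext_iff, aeval_eq_eval]

lemma finrank_homogeneousSubmodule_le (T : Finset Plane) (m : ℕ) :
    Module.finrank ℂ (homogeneousSubmodule (Fin 3) ℂ m) ≤
      T.card + Module.finrank ℂ (vanishingPart T m) := by
  have h := finrank_map_add_finrank_inf_ker (homogeneousSubmodule (Fin 3) ℂ m)
    (LinearMap.pi fun p : T => (aeval p.1.rep : MvPolynomial (Fin 3) ℂ →ₐ[ℂ] ℂ).toLinearMap)
  have h2 := Submodule.finrank_le ((homogeneousSubmodule (Fin 3) ℂ m).map
    (LinearMap.pi fun p : T => (aeval p.1.rep : MvPolynomial (Fin 3) ℂ →ₐ[ℂ] ℂ).toLinearMap))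
  rw [Module.finrank_fintype_fun_eq_card, Fintype.card_coe] at h2
  unfold vanishingPart
  omega

lemma exists_dual_rep_eq_zero {p q : Plane} (h : q ≠ p) :
    ∃ f : Module.Dual ℂ (Fin 3 → ℂ), f q.rep = 0 ∧ f p.rep ≠ 0 := by
  have hmem : p.rep ∉ Submodule.span ℂ {q.rep} := by
    intro hmem
    obtain ⟨a, ha⟩ := Submodule.mem_span_singleton.1 hmem
    refine h ?_
    rw [← p.mk_rep, ← q.mk_rep, Eq.comm, Projectivization.mk_eq_mk_iff']
    exact ⟨a, ha⟩
  obtain ⟨f, hf, hq⟩ := Submodule.exists_le_ker_of_notMem hmem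
  exact ⟨f, hq (Submodule.mem_span_singleton_self _), hf⟩

/-- A product of linear forms vanishes at all points of `T` but one. -/
lemma exists_form_separating (T : Finset Plane) {m : ℕ} (hm : T.card ≤ m) (p : Plane) :
    ∃ H : MvPolynomial (Fin 3) ℂ, H.IsHomogeneous m ∧ eval p.rep H ≠ 0 ∧
      ∀ q ∈ T, q ≠ p → eval q.rep H = 0 := by
  classical
  obtain ⟨g, hg⟩ : ∃ g : Module.Dual ℂ (Fin 3 → ℂ), g p.rep ≠ 0 := by
    by_contra! h
    exact p.rep_nonzero ((Module.forall_dual_apply_eq_zero_iff ℂ _).1 h)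
  have hf (q : Plane) : ∃ f : Module.Dual ℂ (Fin 3 → ℂ), (q ≠ p → f q.rep = 0) ∧ f p.rep ≠ 0 := by
    by_cases h : q = p
    · exact ⟨g, fun h' => absurd h h', hg⟩
    · obtain ⟨f, h1, h2⟩ := exists_dual_rep_eq_zero h
      exact ⟨f, fun _ => h1, h2⟩
  choose f hf0 hfp using hf
  refine ⟨(∏ q ∈ T, linearForm (f q)) * linearForm g ^ (m - T.card), ?_, ?_, ?_⟩
  · have h1 := IsHomogeneous.prod T (fun q => linearForm (f q)) (fun _ => 1)
      fun q _ => isHomogeneous_linearForm _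
    have h2 := (isHomogeneous_linearForm g).pow (m - T.card)
    have h3 := h1.mul h2
    rwa [Finset.sum_const, smul_eq_mul, mul_one, one_mul, Nat.add_sub_cancel' hm] at h3
  · simp only [map_mul, map_prod, map_pow, eval_linearForm]
    exact mul_ne_zero (Finset.prod_ne_zero_iff.2 fun q _ => hfp q) (pow_ne_zero _ hg)
  · intro q hq hqp
    rw [map_mul, map_prod, Finset.prod_eq_zero hq, zero_mul]
    rw [eval_linearForm, hf0 q hqp]

/-- Finitely many points impose independent conditions on forms of large degree. -/
lemma card_add_finrank_vanishingPart {T : Finset Plane} {m : ℕ} (hm : T.card ≤ m) :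
    T.card + Module.finrank ℂ (vanishingPart T m) =
      Module.finrank ℂ (homogeneousSubmodule (Fin 3) ℂ m) := by
  classical
  have h := finrank_map_add_finrank_inf_ker (homogeneousSubmodule (Fin 3) ℂ m)
    (LinearMap.pi fun p : T => (aeval p.1.rep : MvPolynomial (Fin 3) ℂ →ₐ[ℂ] ℂ).toLinearMap)
  have htop : (homogeneousSubmodule (Fin 3) ℂ m).map
      (LinearMap.pi fun p : T => (aeval p.1.rep : MvPolynomial (Fin 3) ℂ →ₐ[ℂ] ℂ).toLinearMap)
      = ⊤ := by
    rw [eq_top_iff, ← (Pi.basisFun ℂ T).span_eq, Submodule.span_le]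
    rintro _ ⟨p, rfl⟩
    obtain ⟨H, hH, hp, hq⟩ := exists_form_separating T hm p.1
    refine ⟨(eval p.1.rep H)⁻¹ • H, Submodule.smul_mem _ _ hH, ?_⟩
    ext q
    rw [Pi.basisFun_apply, Pi.single_apply, LinearMap.pi_apply, AlgHom.toLinearMap_apply,
      map_smul, aeval_eq_eval, smul_eq_mul]
    split_ifs with hqp
    · subst hqp
      exact inv_mul_cancel₀ hp
    · rw [hq q q.2 fun h => hqp (Subtype.ext h), mul_zero]
  rw [htop, finrank_top, Module.finrank_fintype_fun_eq_card, Fintype.card_coe] at h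
  exact h

/-! ### Bézout's theorem for transversal curves -/

section Bezout

variable {F G : MvPolynomial (Fin 3) ℂ} {d : ℕ}

lemma IsTransversal.finrank_idealPart (hF : F.IsHomogeneous d) (hG : G.IsHomogeneous d)
    (hG0 : G ≠ 0) (h : IsTransversal F G) {m : ℕ} (hm : 2 * d ≤ m) :
    Module.finrank ℂ (idealPart F G m) + d ^ 2 =
      Module.finrank ℂ (homogeneousSubmodule (Fin 3) ℂ m) :=
  finrank_idealPart_fin_three hF hG hG0 h.isRelPrime hm

instance finite_idealPart (m : ℕ) : Module.Finite ℂ (idealPart F G m) :=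
  Module.Finite.of_injective _ (Submodule.inclusion_injective
    (inf_le_right : idealPart F G m ≤ homogeneousSubmodule (Fin 3) ℂ m))

instance finite_vanishingPart (T : Finset Plane) (m : ℕ) : Module.Finite ℂ (vanishingPart T m) :=
  Module.Finite.of_injective _ (Submodule.inclusion_injective
    (inf_le_left : vanishingPart T m ≤ homogeneousSubmodule (Fin 3) ℂ m))

/-- Forms in `(F, G)` vanish on `T`, and points impose independent conditions on forms of large
degree; so the codimension `d²` bounds the number of points. -/
lemma card_le_sq (hF : F.IsHomogeneous d) (hG : G.IsHomogeneous d) (hG0 : G ≠ 0)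
    (h : IsTransversal F G) {T : Finset Plane} (hT : (T : Set Plane) ⊆ curve F ∩ curve G) :
    T.card ≤ d ^ 2 := by
  have h1 := IsTransversal.finrank_idealPart hF hG hG0 h (le_max_left (2 * d) T.card)
  have h2 := card_add_finrank_vanishingPart (le_max_right (2 * d) T.card)
  have hle : idealPart F G (max (2 * d) T.card) ≤ vanishingPart T (max (2 * d) T.card) := by
    intro H hH
    rw [mem_vanishingPart]
    refine ⟨hH.2, fun p hp => ?_⟩
    obtain ⟨a, b, rfl⟩ := Ideal.mem_span_pair.1 hH.1
    have h3 : eval p.rep F = 0 := (hT hp).1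
    have h4 : eval p.rep G = 0 := (hT hp).2
    simp [h3, h4]
  have h3 := Submodule.finrank_mono hle
  omega

lemma finite_curve_inter (hF : F.IsHomogeneous d) (hG : G.IsHomogeneous d) (hG0 : G ≠ 0)
    (h : IsTransversal F G) : (curve F ∩ curve G).Finite := by
  by_contra hinf
  obtain ⟨T, hT, hcard⟩ := Set.Infinite.exists_subset_card_eq hinf (d ^ 2 + 1)
  have := card_le_sq hF hG hG0 h hT
  omega

/-- A form in the ideal of an affine chart of `F = G = 0` lies in `(F, G)` after multiplication by
a power of the form at infinity. -/
lemma exists_pow_mul_mem {ℓ : MvPolynomial (Fin 3) ℂ} (hF : F.IsHomogeneous d)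
    (hG : G.IsHomogeneous d) (hℓ : ℓ.IsHomogeneous 1) {H : MvPolynomial (Fin 3) ℂ} {m : ℕ}
    (hH : H.IsHomogeneous m) (hmem : H ∈ affineIdeal F G ℓ) :
    ∃ n, ℓ ^ n * H ∈ Ideal.span {F, G} := by
  obtain ⟨a, ha, b, hb, rfl⟩ := Submodule.mem_sup.1 hmem
  obtain ⟨c, rfl⟩ := Ideal.mem_span_singleton'.1 hb
  set H := a + c * (ℓ - 1) with hHdef
  -- Comparing components of degree `n + 1` and of degree `0` in `H = a + c (ℓ - 1)`.
  have hsucc (n : ℕ) : homogeneousComponent (n + 1) H + homogeneousComponent (n + 1) c -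
      homogeneousComponent n c * ℓ ∈ Ideal.span {F, G} := by
    have h1 := homogeneousComponent_mem_span_pair hF hG ha (n + 1)
    have h2 : homogeneousComponent (n + 1) H = homogeneousComponent (n + 1) a +
        homogeneousComponent n c * ℓ - homogeneousComponent (n + 1) c := by
      rw [← homogeneousComponent_mul_of_isHomogeneous hℓ, ← map_add, ← map_sub, hHdef]
      congr 1
      ring
    rw [h2]
    convert h1 using 1
    ring
  have hzero : homogeneousComponent 0 H + homogeneousComponent 0 c ∈ Ideal.span {F, G} := by
    have h1 := homogeneousComponent_mem_span_pair hF hG ha 0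
    have hℓ0 : constantCoeff ℓ = 0 := hℓ.coeff_eq_zero (by simp)
    have h2 : homogeneousComponent 0 H + homogeneousComponent 0 c = homogeneousComponent 0 a := by
      simp only [homogeneousComponent_zero, ← constantCoeff_eq, hHdef, map_add, map_mul,
        map_sub, hℓ0, map_one, map_zero]
      ring
    rwa [h2]
  have hlow : ∀ j < m, homogeneousComponent j c ∈ Ideal.span {F, G} := by
    intro j
    induction j with
    | zero =>
      intro hj
      rwa [homogeneousComponent_of_mem hH, if_neg (by omega), zero_add] at hzero
    | succ j ih =>
      intro hj
      have h1 := hsucc j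
      rw [homogeneousComponent_of_mem hH, if_neg (by omega), zero_add] at h1
      have := add_mem h1 (Ideal.mul_mem_right ℓ _ (ih (by omega)))
      simpa using this
  have hhigh : ∀ j, homogeneousComponent (m + j) c + ℓ ^ j * H ∈ Ideal.span {F, G} := by
    intro j
    induction j with
    | zero =>
      rw [add_zero, pow_zero, one_mul, add_comm]
      rcases m with _ | m
      · rwa [homogeneousComponent_of_mem hH, if_pos rfl] at hzero
      · have h1 := hsucc m
        rw [homogeneousComponent_of_mem hH, if_pos rfl] at h1
        have := add_mem h1 (Ideal.mul_mem_right ℓ _ (hlow m (by omega)))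
        simpa using this
    | succ j ih =>
      have h1 := hsucc (m + j)
      rw [homogeneousComponent_of_mem hH, if_neg (by omega), zero_add] at h1
      have h2 := add_mem h1 (Ideal.mul_mem_right ℓ _ ih)
      rw [← add_assoc]
      convert h2 using 1
      ring
  refine ⟨c.totalDegree + 1, ?_⟩
  have := hhigh (c.totalDegree + 1)
  rwa [homogeneousComponent_eq_zero _ _ (by omega), zero_add] at this

/-- In large degrees the forms modulo `(F, G)` are multiples of a linear form `ℓ` without zeros on
`F = G = 0`. -/
lemma exists_forall_sub_mul_mem {ℓ : MvPolynomial (Fin 3) ℂ} (hF : F.IsHomogeneous d)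
    (hG : G.IsHomogeneous d) (hℓ : ℓ.IsHomogeneous 1)
    (hz : ∀ v, eval v F = 0 → eval v G = 0 → eval v ℓ = 0 → v = 0) :
    ∃ N, ∀ m, N ≤ m → ∀ H : MvPolynomial (Fin 3) ℂ, H.IsHomogeneous (m + 1) →
      ∃ H' : MvPolynomial (Fin 3) ℂ, H'.IsHomogeneous m ∧ H - ℓ * H' ∈ Ideal.span {F, G} := by
  have hrad : Ideal.span (Set.range (X : Fin 3 → MvPolynomial (Fin 3) ℂ)) ≤
      (Ideal.span {F, G} ⊔ Ideal.span {ℓ}).radical := by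
    rw [Ideal.span_le]
    rintro _ ⟨i, rfl⟩
    rw [SetLike.mem_coe, ← vanishingIdeal_zeroLocus_eq_radical (K := ℂ), mem_vanishingIdeal_iff]
    intro v hv
    have hv' : ∀ p ∈ Ideal.span {F, G} ⊔ Ideal.span {ℓ}, eval v p = 0 := by
      intro p hp
      have := hv p hp
      rwa [aeval_eq_eval] at this
    have hv0 : v = 0 := hz v
      (hv' F (Ideal.mem_sup_left (Ideal.subset_span (by simp))))
      (hv' G (Ideal.mem_sup_left (Ideal.subset_span (by simp))))
      (hv' ℓ (Ideal.mem_sup_right (Ideal.subset_span (by simp))))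
    simp [hv0]
  obtain ⟨N, hN⟩ := Ideal.exists_pow_le_of_le_radical_of_fg hrad (IsNoetherian.noetherian _)
  refine ⟨N, fun m hm H hH => ?_⟩
  have hHX : H ∈ Ideal.span (Set.range (X : Fin 3 → MvPolynomial (Fin 3) ℂ)) ^ (m + 1) := by
    rw [Ideal.mem_span_pow_iff_exists_isHomogeneous]
    exact ⟨map C H, hH.map C, by rw [eval_map, eval₂_eta]⟩
  obtain ⟨a, ha, b, hb, hab⟩ := Submodule.mem_sup.1 (hN (Ideal.pow_le_pow_right (by omega) hHX))
  obtain ⟨c, rfl⟩ := Ideal.mem_span_singleton'.1 hb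
  refine ⟨homogeneousComponent m c, homogeneousComponent_isHomogeneous m c, ?_⟩
  have h1 := homogeneousComponent_mem_span_pair hF hG ha (m + 1)
  have h2 : homogeneousComponent (m + 1) H = homogeneousComponent (m + 1) a +
      homogeneousComponent m c * ℓ := by
    rw [← homogeneousComponent_mul_of_isHomogeneous hℓ, ← map_add, hab]
  rw [homogeneousComponent_eq_self hH] at h2
  rw [h2]
  convert h1 using 1
  ring

/-- Multiplication by `ℓ` is injective on the forms modulo `(F, G)` in large degrees: it is
surjective between spaces of the same dimension `d²`. -/
lemma exists_forall_mem_of_mul_mem {ℓ : MvPolynomial (Fin 3) ℂ} (hF : F.IsHomogeneous d)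
    (hG : G.IsHomogeneous d) (hG0 : G ≠ 0) (h : IsTransversal F G) (hℓ : ℓ.IsHomogeneous 1)
    (hz : ∀ v, eval v F = 0 → eval v G = 0 → eval v ℓ = 0 → v = 0) :
    ∃ N, ∀ m, N ≤ m → ∀ H : MvPolynomial (Fin 3) ℂ, H.IsHomogeneous m →
      ℓ * H ∈ Ideal.span {F, G} → H ∈ Ideal.span {F, G} := by
  obtain ⟨N, hN⟩ := exists_forall_sub_mul_mem hF hG hℓ hz
  refine ⟨max N (2 * d), fun m hm H hH hmem => ?_⟩
  let q := ((Ideal.span {F, G}).restrictScalars ℂ).mkQ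
  have hq (P) : q P = 0 ↔ P ∈ Ideal.span {F, G} := Submodule.Quotient.mk_eq_zero _
  let f := q ∘ₗ LinearMap.mulLeft ℂ ℓ
  have hmap : (homogeneousSubmodule (Fin 3) ℂ m).map f =
      (homogeneousSubmodule (Fin 3) ℂ (m + 1)).map q := by
    apply le_antisymm
    · rintro _ ⟨P, hP, rfl⟩
      exact ⟨ℓ * P, by simpa [add_comm] using hℓ.mul hP, rfl⟩
    · rintro _ ⟨P, hP, rfl⟩
      obtain ⟨P', hP', hsub⟩ := hN m (le_of_max_le_left hm) P hP
      refine ⟨P', hP', ?_⟩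
      have := (hq _).2 hsub
      rw [map_sub, sub_eq_zero] at this
      exact this.symm
  have hker : homogeneousSubmodule (Fin 3) ℂ (m + 1) ⊓ LinearMap.ker q =
      idealPart F G (m + 1) := by
    rw [Submodule.ker_mkQ, inf_comm]
    rfl
  have h1 := finrank_map_add_finrank_inf_ker (homogeneousSubmodule (Fin 3) ℂ m) f
  have h2 := finrank_map_add_finrank_inf_ker (homogeneousSubmodule (Fin 3) ℂ (m + 1)) q
  have h3 := IsTransversal.finrank_idealPart hF hG hG0 h (le_of_max_le_right hm)
  have h4 := IsTransversal.finrank_idealPart hF hG hG0 h (m := m + 1)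
    ((le_of_max_le_right hm).trans (Nat.le_succ m))
  rw [hmap] at h1
  rw [hker] at h2
  have hle : idealPart F G m ≤ homogeneousSubmodule (Fin 3) ℂ m ⊓ LinearMap.ker f := by
    intro P hP
    exact ⟨hP.2, (hq _).2 (Ideal.mul_mem_left _ ℓ hP.1)⟩
  have hfin : Module.Finite ℂ
      (homogeneousSubmodule (Fin 3) ℂ m ⊓ LinearMap.ker f : Submodule ℂ _) :=
    Module.Finite.of_injective _ (Submodule.inclusion_injective inf_le_left)
  have heq := Submodule.eq_of_le_of_finrank_eq hle (by omega)
  have : H ∈ idealPart F G m := by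
    rw [heq]
    exact ⟨hH, (hq _).2 hmem⟩
  exact this.1

/-- Bézout's theorem for two transversal curves of the same degree. -/
theorem ncard_curve_inter (hF : F.IsHomogeneous d) (hG : G.IsHomogeneous d) (hG0 : G ≠ 0)
    (h : IsTransversal F G) : (curve F ∩ curve G).ncard = d ^ 2 := by
  have hfin := finite_curve_inter hF hG hG0 h
  obtain ⟨T, hT⟩ := hfin.exists_finset_coe
  rw [← hT, Set.ncard_coe_finset]
  refine le_antisymm (card_le_sq hF hG hG0 h hT.le) ?_
  obtain ⟨f, hf⟩ := Module.exists_dual_forall_apply_ne_zero (K := ℂ)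
    (fun p : T => p.1.rep) fun p => p.1.rep_nonzero
  have hrep (v : Fin 3 → ℂ) (hv : v ≠ 0) (h1 : eval v F = 0) (h2 : eval v G = 0) :
      ∃ p ∈ T, ∃ a : ℂ, a ≠ 0 ∧ v = a • p.rep := by
    obtain ⟨a, ha⟩ := Projectivization.exists_smul_eq_mk_rep ℂ v hv
    refine ⟨Projectivization.mk ℂ v hv, ?_, (a⁻¹ : ℂˣ), Units.ne_zero _, ?_⟩
    · rw [← Finset.mem_coe, hT]
      constructor
      · change eval _ F = 0
        rw [← ha, Units.smul_def, eval_smul_of_isHomogeneous hF, h1, mul_zero]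
      · change eval _ G = 0
        rw [← ha, Units.smul_def, eval_smul_of_isHomogeneous hG, h2, mul_zero]
    · rw [← ha, ← Units.smul_def, inv_smul_smul]
  have hz (v : Fin 3 → ℂ) (h1 : eval v F = 0) (h2 : eval v G = 0)
      (h3 : eval v (linearForm f) = 0) : v = 0 := by
    by_contra hv
    obtain ⟨p, hp, a, ha, rfl⟩ := hrep v hv h1 h2
    rw [eval_linearForm, map_smul, smul_eq_mul] at h3
    exact mul_ne_zero ha (hf ⟨p, hp⟩) h3
  obtain ⟨N, hN⟩ := exists_forall_mem_of_mul_mem hF hG hG0 h (isHomogeneous_linearForm f) hz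
  have hle : vanishingPart T (max N (2 * d)) ≤ idealPart F G (max N (2 * d)) := by
    intro H hH
    obtain ⟨hHm, hH0⟩ := mem_vanishingPart.1 hH
    refine mem_idealPart.2 ⟨?_, hHm⟩
    have hmem : H ∈ affineIdeal F G (linearForm f) := by
      refine mem_affineIdeal_of_forall_eval_eq_zero hF hG h (isHomogeneous_linearForm f)
        fun v h1 h2 h3 => ?_
      have hv : v ≠ 0 := by
        rintro rfl
        rw [eval_linearForm, map_zero] at h3
        exact zero_ne_one h3
      obtain ⟨p, hp, a, -, rfl⟩ := hrep v hv h1 h2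
      rw [eval_smul_of_isHomogeneous hHm, hH0 p hp, mul_zero]
    obtain ⟨n, hn⟩ := exists_pow_mul_mem hF hG (isHomogeneous_linearForm f) hHm hmem
    induction n with
    | zero => simpa using hn
    | succ n ih =>
      refine ih (hN (n + max N (2 * d)) (by omega) _ ?_ ?_)
      · simpa using ((isHomogeneous_linearForm f).pow n).mul hHm
      · rwa [← mul_assoc, ← pow_succ']
  have h1 := Submodule.finrank_mono hle
  have h2 := IsTransversal.finrank_idealPart hF hG hG0 h (le_max_right N (2 * d))
  have h3 := finrank_homogeneousSubmodule_le T (max N (2 * d))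
  omega

end Bezout

/-! ### Curves of an arrangement meet transversally -/

lemma mem_tangentLine {F : MvPolynomial (Fin 3) ℂ} {p : Plane} {w : Fin 3 → ℂ} :
    w ∈ tangentLine F p ↔ grad F p.rep ⬝ᵥ w = 0 := by
  simp [tangentLine, dotProduct]

lemma linearIndependent_of_tangentLine_ne {F G : MvPolynomial (Fin 3) ℂ} {p : Plane}
    (hF : grad F p.rep ≠ 0) (hG : grad G p.rep ≠ 0) (h : tangentLine F p ≠ tangentLine G p) :
    LinearIndependent ℂ ![grad F p.rep, grad G p.rep] := by
  rw [LinearIndependent.pair_iff' hF]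
  intro a ha
  have ha0 : a ≠ 0 := by
    rintro rfl
    exact hG (by rw [← ha, zero_smul])
  refine h ?_
  ext w
  rw [mem_tangentLine, mem_tangentLine, ← ha, smul_dotProduct, smul_eq_zero_iff_right ha0]

lemma grad_smul_of_isHomogeneous {F : MvPolynomial (Fin 3) ℂ} {d : ℕ} (hF : F.IsHomogeneous d)
    (a : ℂ) (v : Fin 3 → ℂ) : grad F (a • v) = a ^ (d - 1) • grad F v := by
  ext i
  exact eval_smul_of_isHomogeneous hF.pderiv a v

lemma IsSmooth.ne_zero {F : MvPolynomial (Fin 3) ℂ} (h : IsSmooth F) : F ≠ 0 := by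
  rintro rfl
  refine h 1 one_ne_zero (map_zero _) ?_
  ext i
  simp [grad]

variable {d k : ℕ} {F : Fin k → MvPolynomial (Fin 3) ℂ}

lemma mem_sing_of_mem_curve {i j : Fin k} (hij : i ≠ j) {p : Plane} (hi : p ∈ curve (F i))
    (hj : p ∈ curve (F j)) : p ∈ sing F := by
  change 2 ≤ mult F p
  have h : ({i, j} : Set (Fin k)).ncard ≤ mult F p := by
    refine Set.ncard_le_ncard ?_ (Set.toFinite _)
    rintro l (rfl | rfl)
    · exact hi
    · exact hj
  rwa [Set.ncard_pair hij] at h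

lemma IsDArrangement.isTransversal (hF : IsDArrangement d F) {i j : Fin k} (hij : i ≠ j) :
    IsTransversal (F i) (F j) := by
  intro v hv hi hj
  let p : Plane := Projectivization.mk ℂ v hv
  obtain ⟨a, ha⟩ := Projectivization.exists_smul_eq_mk_rep ℂ v hv
  rw [Units.smul_def] at ha
  have hpi : eval p.rep (F i) = 0 := by
    rw [← ha, eval_smul_of_isHomogeneous (hF.isHomogeneous i), hi, mul_zero]
  have hpj : eval p.rep (F j) = 0 := by
    rw [← ha, eval_smul_of_isHomogeneous (hF.isHomogeneous j), hj, mul_zero]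
  have h := linearIndependent_of_tangentLine_ne (hF.isSmooth i _ p.rep_nonzero hpi)
    (hF.isSmooth j _ p.rep_nonzero hpj)
    (hF.isOrdinary p (mem_sing_of_mem_curve hij hpi hpj) i j hij hpi hpj)
  rw [← ha, grad_smul_of_isHomogeneous (hF.isHomogeneous i),
    grad_smul_of_isHomogeneous (hF.isHomogeneous j), LinearIndependent.pair_iff] at h
  have ha0 : (a : ℂ) ^ (d - 1) ≠ 0 := pow_ne_zero _ a.ne_zero
  rw [LinearIndependent.pair_iff]
  intro s t hst
  refine h s t ?_
  rw [smul_comm s, smul_comm t, ← smul_add, hst, smul_zero]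

lemma IsDArrangement.ncard_inter (hF : IsDArrangement d F) {i j : Fin k} (hij : i ≠ j) :
    (curve (F i) ∩ curve (F j)).ncard = d ^ 2 :=
  ncard_curve_inter (hF.isHomogeneous i) (hF.isHomogeneous j) (hF.isSmooth j).ne_zero
    (hF.isTransversal hij)

lemma IsDArrangement.finite_sing (hF : IsDArrangement d F) : (sing F).Finite := by
  have hsub : sing F ⊆ ⋃ i, ⋃ j, ⋃ _ : i ≠ j, curve (F i) ∩ curve (F j) := by
    intro p hp
    obtain ⟨i, hi, j, hj, hij⟩ := (Set.one_lt_ncard (Set.toFinite _)).1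
      (show 1 < {i | p ∈ curve (F i)}.ncard from hp)
    simp only [Set.mem_iUnion]
    exact ⟨i, j, hij, hi, hj⟩
  refine Set.Finite.subset ?_ hsub
  exact Set.finite_iUnion fun i => Set.finite_iUnion fun j => Set.finite_iUnion fun hij =>
    finite_curve_inter (hF.isHomogeneous i) (hF.isHomogeneous j) (hF.isSmooth j).ne_zero
      (hF.isTransversal hij)

/-! ### Set systems with constant intersections -/

/-- The nonuniform Fisher inequality, as a statement on systems of distinct representatives: if any
two of the sets `N i` meet in exactly `n` points and every `N i` has more than `n` points, then
the incidence vectors of the `N i` are linearly independent, so Hall's condition holds. -/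
lemma exists_injective_of_card_inter_eq {ι α : Type*} [Fintype ι] [DecidableEq α]
    (N : ι → Finset α) (n : ℕ) (hinter : ∀ i j, i ≠ j → (N i ∩ N j).card = n)
    (hcard : ∀ i, n < (N i).card) :
    ∃ f : ι → α, Function.Injective f ∧ ∀ i, f i ∈ N i := by
  classical
  rw [← Finset.all_card_le_biUnion_card_iff_exists_injective]
  intro S
  let U := S.biUnion N
  let a : S → U → ℝ := fun i p => if p.1 ∈ N i then 1 else 0
  have hdot (i j : S) : ∑ p, a i p * a j p = ((N i ∩ N j).card : ℝ) := by
    have : ∑ p : U, a i p * a j p = ∑ p ∈ U, if p ∈ N i ∩ N j then (1 : ℝ) else 0 := by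
      rw [← Finset.sum_coe_sort U]
      refine Finset.sum_congr rfl fun p _ => ?_
      simp only [a, Finset.mem_inter]
      split_ifs <;> simp_all
    rw [this, Finset.sum_boole, Finset.filter_mem_eq_inter, Finset.inter_eq_right.2]
    exact Finset.inter_subset_left.trans (Finset.subset_biUnion_of_mem N i.2)
  have hli : LinearIndependent ℝ a := by
    rw [Fintype.linearIndependent_iff]
    intro x hx
    -- The Gram matrix of the incidence vectors is `diag (#(N i) - n)`, which is positive definite,
    -- plus `n` times the matrix of ones, which is positive semidefinite.
    have hgram (i j : S) : ((N i ∩ N j).card : ℝ) =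
        n + if i = j then ((N i).card - n : ℝ) else 0 := by
      split_ifs with hij
      · subst hij
        rw [Finset.inter_self]
        ring
      · rw [hinter i j fun h => hij (Subtype.ext h), add_zero]
    have hsq : ∑ i, x i ^ 2 * ((N i).card - n : ℝ) + n * (∑ i, x i) ^ 2 = 0 := by
      calc ∑ i, x i ^ 2 * ((N i).card - n : ℝ) + n * (∑ i, x i) ^ 2
          = ∑ i, ∑ j, x i * x j * ((N i ∩ N j).card : ℝ) := by
            simp only [hgram, mul_add, Finset.sum_add_distrib, mul_ite, mul_zero,
              Finset.sum_ite_eq, Finset.mem_univ, if_true]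
            rw [add_comm, sq (∑ i, x i), Finset.sum_mul_sum, Finset.mul_sum]
            congr 1
            · refine Finset.sum_congr rfl fun i _ => ?_
              rw [Finset.mul_sum]
              exact Finset.sum_congr rfl fun j _ => mul_comm _ _
            · exact Finset.sum_congr rfl fun i _ => by ring
        _ = ∑ p, (∑ i, x i • a i) p ^ 2 := by
            simp only [Finset.sum_apply, Pi.smul_apply, smul_eq_mul, sq, Finset.sum_mul_sum]
            rw [Finset.sum_comm (s := Finset.univ (α := U))]
            refine Finset.sum_congr rfl fun i _ => ?_
            rw [Finset.sum_comm (s := Finset.univ (α := U))]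
            refine Finset.sum_congr rfl fun j _ => ?_
            rw [← hdot, Finset.mul_sum]
            exact Finset.sum_congr rfl fun p _ => by ring
        _ = 0 := by rw [hx]; simp
    have hpos (i : S) : (0 : ℝ) < (N i).card - n := by
      rw [sub_pos]
      exact_mod_cast hcard i
    have hnonneg : ∀ i ∈ Finset.univ, 0 ≤ x i ^ 2 * ((N i).card - n : ℝ) :=
      fun i _ => mul_nonneg (sq_nonneg _) (hpos i).le
    have hzero : ∑ i, x i ^ 2 * ((N i).card - n : ℝ) = 0 := by
      have h1 := Finset.sum_nonneg hnonneg
      have h2 : (0 : ℝ) ≤ n * (∑ i, x i) ^ 2 := by positivity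
      linarith
    intro i
    have := (Finset.sum_eq_zero_iff_of_nonneg hnonneg).1 hzero i (Finset.mem_univ i)
    exact pow_eq_zero_iff two_ne_zero |>.1 ((mul_eq_zero.1 this).resolve_right (hpos i).ne')
  have := hli.fintype_card_le_finrank
  rwa [Module.finrank_fintype_fun_eq_card, Fintype.card_coe, Fintype.card_coe] at this

/-! ### The matching -/

/-- Every curve of the arrangement carries more than `d²` singular points, unless some point lies
on all the curves. -/
lemma IsDArrangement.sq_lt_ncard (hF : IsDArrangement d F) (hd : 1 ≤ d) (hk : 2 ≤ k)
    (ht : t F k = 0) (i : Fin k) : d ^ 2 < (curve (F i) ∩ sing F).ncard := by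
  have hsub (j : Fin k) (hij : i ≠ j) : curve (F i) ∩ curve (F j) ⊆ curve (F i) ∩ sing F :=
    fun p hp => ⟨hp.1, mem_sing_of_mem_curve hij hp.1 hp.2⟩
  have hfin : (curve (F i) ∩ sing F).Finite := hF.finite_sing.subset Set.inter_subset_right
  by_contra! hle
  have heq (j : Fin k) (hij : i ≠ j) : curve (F i) ∩ curve (F j) = curve (F i) ∩ sing F :=
    Set.eq_of_subset_of_ncard_le (hsub j hij) (hle.trans (hF.ncard_inter hij).ge) hfin
  have : Nontrivial (Fin k) := Fin.nontrivial_iff_two_le.2 hk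
  obtain ⟨j, hj⟩ := exists_ne i
  have hne : (curve (F i) ∩ curve (F j)).Nonempty := by
    refine Set.nonempty_of_ncard_ne_zero ?_
    rw [hF.ncard_inter hj.symm]
    positivity
  obtain ⟨p, hp⟩ := hne
  have hall (l : Fin k) : p ∈ curve (F l) := by
    by_cases hl : i = l
    · exact hl ▸ hp.1
    · have : p ∈ curve (F i) ∩ curve (F l) := by rwa [heq l hl, ← heq j hj.symm]
      exact this.2
  have hmult : mult F p = k := by
    have : {l | p ∈ curve (F l)} = Set.univ := Set.eq_univ_of_forall hall
    rw [mult, this, Set.ncard_univ, Nat.card_fin]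
  exact Set.notMem_empty p (Set.encard_eq_zero.1 ht ▸ hmult)

lemma IsDArrangement.exists_injective (hF : IsDArrangement d F) (hd : 1 ≤ d) (hk : 2 ≤ k)
    (ht : t F k = 0) :
    ∃ f : Fin k → sing F, Function.Injective f ∧ ∀ i, (f i : Plane) ∈ curve (F i) := by
  classical
  have hfin (i : Fin k) : (curve (F i) ∩ sing F).Finite :=
    hF.finite_sing.subset Set.inter_subset_right
  obtain ⟨f, hf, hmem⟩ := exists_injective_of_card_inter_eq (fun i => (hfin i).toFinset) (d ^ 2)
    (fun i j hij => by
      rw [← hF.ncard_inter hij, ← Set.ncard_coe_finset]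
      congr 1
      ext p
      simp only [Finset.coe_inter, Set.Finite.coe_toFinset, Set.mem_inter_iff]
      exact ⟨fun h => ⟨h.1.1, h.2.1⟩, fun h => ⟨⟨h.1, mem_sing_of_mem_curve hij h.1 h.2⟩,
        h.2, mem_sing_of_mem_curve hij h.1 h.2⟩⟩)
    (fun i => by
      rw [← Set.ncard_eq_toFinset_card _ (hfin i)]
      exact hF.sq_lt_ncard hd hk ht i)
  simp only [Set.Finite.mem_toFinset] at hmem
  exact ⟨fun i => ⟨f i, (hmem i).2⟩, fun i j h => hf (congrArg Subtype.val h),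
    fun i => (hmem i).1⟩

/-- The subgraph of the Levi graph with edges joining each curve to a chosen point on it. -/
def choiceSubgraph (f : Fin k → sing F) (hf : ∀ i, (f i : Plane) ∈ curve (F i)) :
    (leviGraph F).Subgraph where
  verts := Set.range (Sum.inl ∘ f) ∪ Set.range Sum.inr
  Adj x y := ∃ i, (x = Sum.inl (f i) ∧ y = Sum.inr i) ∨ (x = Sum.inr i ∧ y = Sum.inl (f i))
  adj_sub := by
    rintro _ _ ⟨i, ⟨rfl, rfl⟩ | ⟨rfl, rfl⟩⟩ <;> exact hf i
  edge_vert := by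
    rintro _ _ ⟨i, ⟨rfl, rfl⟩ | ⟨rfl, rfl⟩⟩
    · exact Or.inl ⟨i, rfl⟩
    · exact Or.inr ⟨i, rfl⟩
  symm := ⟨by
    rintro _ _ ⟨i, ⟨rfl, rfl⟩ | ⟨rfl, rfl⟩⟩
    · exact ⟨i, Or.inr ⟨rfl, rfl⟩⟩
    · exact ⟨i, Or.inl ⟨rfl, rfl⟩⟩⟩

lemma isMatching_choiceSubgraph {f : Fin k → sing F} (hinj : Function.Injective f)
    (hf : ∀ i, (f i : Plane) ∈ curve (F i)) : (choiceSubgraph f hf).IsMatching := by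
  rintro _ (⟨i, rfl⟩ | ⟨i, rfl⟩)
  · refine ⟨Sum.inr i, ⟨i, Or.inl ⟨rfl, rfl⟩⟩, ?_⟩
    rintro y ⟨j, ⟨h1, rfl⟩ | ⟨h1, -⟩⟩
    · rw [hinj (Sum.inl_injective h1)]
    · cases h1
  · refine ⟨Sum.inl (f i), ⟨i, Or.inr ⟨rfl, rfl⟩⟩, ?_⟩
    rintro y ⟨j, ⟨h1, -⟩ | ⟨h1, rfl⟩⟩
    · cases h1
    · rw [Sum.inr_injective h1]

lemma encard_edgeSet_choiceSubgraph (f : Fin k → sing F)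
    (hf : ∀ i, (f i : Plane) ∈ curve (F i)) : (choiceSubgraph f hf).edgeSet.encard = k := by
  have hrange : (choiceSubgraph f hf).edgeSet =
      Set.range fun i => s(Sum.inl (f i), (Sum.inr i : sing F ⊕ Fin k)) := by
    ext e
    induction e with | h x y
    rw [SimpleGraph.Subgraph.mem_edgeSet, Set.mem_range]
    refine exists_congr fun i => ?_
    rw [Sym2.eq_iff]
    simp only [eq_comm]
    tauto
  rw [hrange, ← Set.image_univ, Function.Injective.encard_image, Set.encard_univ]
  · simp
  · intro i j h
    exact (by simpa using h : f i = f j ∧ i = j).2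

end CurveArrangement

theorem mainTheorem7 (d k : ℕ) (hd : 1 ≤ d) (hk : 3 ≤ k)
    (F : Fin k → MvPolynomial (Fin 3) ℂ) (hF : CurveArrangement.IsDArrangement d F)
    (ht : CurveArrangement.t F k = 0) :
    ∃ M : (CurveArrangement.leviGraph F).Subgraph,
      M.IsMatching ∧ M.edgeSet.encard = k ∧ ∀ i : Fin k, Sum.inr i ∈ M.verts := by
  obtain ⟨f, hinj, hf⟩ := hF.exists_injective hd (by omega) ht
  exact ⟨CurveArrangement.choiceSubgraph f hf,
    CurveArrangement.isMatching_choiceSubgraph hinj hf,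
    CurveArrangement.encard_edgeSet_choiceSubgraph f hf, fun i => Or.inr ⟨i, rfl⟩⟩
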